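/- Let $0<\theta<1$ and let $s\ge 1$ be an integer. A list of $N$ candidates is interviewed in a random order $\pi\in S_N$ drawn from the Mallows distribution $P(\pi)=\theta^{\mathrm{inv}(\pi)}/\sum_{\rho\in S_N}\theta^{\mathrm{inv}(\rho)}$, where $\mathrm{inv}(\pi)$ is the number of inversions of $\pi$ and the candidate of value $N$ is the best one. For integers $0\le k_1\le\dots\le k_s\le N-1$, the $(k_1,\dots,k_s)$-strategy makes at most $s$ selections: after $i-1$ selections have been made ($1\le i\le s$), its $i$-th selection is the next left-to-right maximum (a candidate better than all earlier ones) at a position greater than $k_i$. The strategy wins if the best candidate is among the selected ones; let $w_N(k_1,\dots,k_s)$ be the probability of this. A sequence of $s$-threshold strategies, with thresholds $k_1(N)\le\dots\le k_s(N)\le N-1$ for $N\ge 1$, is called asymptotically optimal if $$\max_{0\le k_1'\le\dots\le k_s'\le N-1} w_N(k_1',\dots,k_s')-w_N(k_1(N),\dots,k_s(N))\longrightarrow 0\qquad (N\to\infty).$$ Then there is a constant $C=C(\theta,s)$ such that every asymptotically optimal sequence of $s$-threshold strategies satisfies $N-k_1(N)\le C$, and hence $N-k_i(N)\le C$ for all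 $1\le i\le s$, for all sufficiently large $N$. In particular $N-k_1(N)$ is bounded (it does not tend to $\infty$), and all thresholds lie within a bounded distance of the end of the list. -/

import Mathlib

open Filter

namespace Mallows

/-- The number of inversions of the interview order `π` (candidate `π p` is interviewed at
position `p`; larger values are better candidates), i.e. its Kendall tau distance to the
identity. Positions and values are numbered `0, …, N - 1`. -/
def inversions {N : ℕ} (π : Equiv.Perm (Fin N)) : ℕ :=
  (Finset.univ.filter fun x : Fin N × Fin N => x.1 < x.2 ∧ π x.2 < π x.1).card

/-- The Mallows probability of the interview order `π`. -/
noncomputable def prob (θ : ℝ) {N : ℕ} (π : Equiv.Perm (Fin N)) : ℝ :=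
  θ ^ inversions π / ∑ ρ : Equiv.Perm (Fin N), θ ^ inversions ρ

/-- Position `p` is a left-to-right maximum of `π`. -/
def IsLTRMax {N : ℕ} (π : Equiv.Perm (Fin N)) (p : Fin N) : Prop :=
  ∀ q : Fin N, q < p → π q < π p

instance {N : ℕ} (π : Equiv.Perm (Fin N)) (p : Fin N) : Decidable (IsLTRMax π p) :=
  inferInstanceAs (Decidable (∀ q : Fin N, q < p → π q < π p))

/-- The decision of the `(k 0, …, k (s - 1))`-strategy at position `p` when `r` selections have
been made before: the candidate is selected iff a selection is left (`r < s`), the candidate is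
not among the first `k r` ones (`k r` being the threshold of the next selection, and `p` being
preceded by exactly `p` candidates), and it is a left-to-right maximum. -/
def Accepts {N s : ℕ} (k : Fin s → ℕ) (π : Equiv.Perm (Fin N)) (r : ℕ) (p : Fin N) : Prop :=
  (∃ hr : r < s, k ⟨r, hr⟩ ≤ (p : ℕ)) ∧ IsLTRMax π p

instance {N s : ℕ} (k : Fin s → ℕ) (π : Equiv.Perm (Fin N)) (r : ℕ) (p : Fin N) :
    Decidable (Accepts k π r p) :=
  inferInstanceAs (Decidable ((∃ hr : r < s, k ⟨r, hr⟩ ≤ (p : ℕ)) ∧ IsLTRMax π p))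

/-- The number of selections that the threshold strategy `k` makes among the first `m`
candidates of `π`. -/
def numSelections {N s : ℕ} (k : Fin s → ℕ) (π : Equiv.Perm (Fin N)) : ℕ → ℕ
  | 0 => 0
  | m + 1 =>
    if ∃ hm : m < N, Accepts k π (numSelections k π m) ⟨m, hm⟩ then numSelections k π m + 1
    else numSelections k π m

/-- `π` is `k`-winnable: the best candidate is one of the candidates selected by the threshold
strategy `k`. (Stopping once the best candidate has been selected makes no difference.) -/
def Winnable {N s : ℕ} (k : Fin s → ℕ) (π : Equiv.Perm (Fin N)) : Prop :=
  ∃ p : Fin N, (∀ q : Fin N, π q ≤ π p) ∧ Accepts k π (numSelections k π p) p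

instance {N s : ℕ} (k : Fin s → ℕ) (π : Equiv.Perm (Fin N)) : Decidable (Winnable k π) :=
  inferInstanceAs (Decidable
    (∃ p : Fin N, (∀ q : Fin N, π q ≤ π p) ∧ Accepts k π (numSelections k π p) p))

/-- The probability that the threshold strategy `k` wins on a Mallows list of length `N`. -/
noncomputable def winProb (θ : ℝ) (N : ℕ) {s : ℕ} (k : Fin s → ℕ) : ℝ :=
  ∑ π : Equiv.Perm (Fin N) with Winnable k π, prob θ π

/-- `k` is an admissible threshold vector for lists of length `N`:
`k 0 ≤ k 1 ≤ … ≤ k (s - 1) ≤ N - 1`. -/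
def IsThresholdVector (N : ℕ) {s : ℕ} (k : Fin s → ℕ) : Prop :=
  Monotone k ∧ ∀ i, k i < N

/-- A sequence of `s`-threshold strategies, with thresholds `k N` for lists of length `N ≥ 1`, is
asymptotically optimal: its winning probability falls short of the best one attainable by an
`s`-threshold strategy by an amount that tends to `0` as `N → ∞`. -/
def AsymptoticallyOptimal (θ : ℝ) {s : ℕ} (k : ℕ → Fin s → ℕ) : Prop :=
  (∀ N, 1 ≤ N → IsThresholdVector N (k N)) ∧
    ∀ ε : ℝ, 0 < ε → ∀ᶠ N : ℕ in atTop, ∀ k' : Fin s → ℕ, IsThresholdVector N k' →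
      winProb θ N k' ≤ winProb θ N (k N) + ε

end Mallows

/-! Under the Mallows law the left-to-right maxima occur independently, at position `p` with
probability `1 / (1 + θ + ... + θ ^ p) ≥ 1 - θ`. Hence `winProb_eq` turns the winning probability
into the recursion `suffixWin`. If the first threshold is `n` places before the end, the first
selected candidate is best only if it is the sole maximum among the last `n` positions, which has
probability at most `n * θ ^ (n - 1)`. So for large `n` that selection is wasted, and `s + 1`
selections do hardly better than the optimum for `s` (`suffixWin_cons_le`). Yet one more selection
gains a fixed `δ > 0` (`exists_gain`, by induction on `s`): once optimal thresholds are known to lie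
near the end, an extra one placed just before them wins additionally with probability bounded below.
Together these exclude early first thresholds (`exists_better_of_gain`). -/

namespace Mallows

/-! ### Appending a last candidate -/

/-- The permutation of `Fin (n + 1)` whose last value is `v` and whose first `n` values are in the
same relative order as those of `σ`. -/
noncomputable def insertLast {n : ℕ} (v : Fin (n + 1)) (σ : Equiv.Perm (Fin n)) :
    Equiv.Perm (Fin (n + 1)) :=
  Equiv.ofBijective (Fin.lastCases v fun i => v.succAbove (σ i)) <| by
    rw [← Finite.injective_iff_bijective]
    intro x y
    induction x using Fin.lastCases <;> induction y using Fin.lastCases <;>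
      simp [Fin.succAbove_ne, (Fin.succAbove_ne _ _).symm]

@[simp]
theorem insertLast_last {n : ℕ} (v : Fin (n + 1)) (σ : Equiv.Perm (Fin n)) :
    insertLast v σ (Fin.last n) = v := by
  simp [insertLast]

@[simp]
theorem insertLast_castSucc {n : ℕ} (v : Fin (n + 1)) (σ : Equiv.Perm (Fin n)) (i : Fin n) :
    insertLast v σ i.castSucc = v.succAbove (σ i) := by
  simp [insertLast]

theorem insertLast_bijective (n : ℕ) :
    Function.Bijective fun x : Fin (n + 1) × Equiv.Perm (Fin n) => insertLast x.1 x.2 := by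
  rw [Fintype.bijective_iff_injective_and_card]
  refine ⟨?_, ?_⟩
  · rintro ⟨v, σ⟩ ⟨w, τ⟩ h
    have hv : v = w := by simpa using DFunLike.congr_fun h (Fin.last n)
    subst hv
    have : σ = τ := by
      ext1 i
      simpa using DFunLike.congr_fun h i.castSucc
    rw [this]
  · simp [Fintype.card_perm, Nat.factorial_succ]

theorem sum_perm_succ {n : ℕ} (f : Equiv.Perm (Fin (n + 1)) → ℝ) :
    ∑ π, f π = ∑ σ : Equiv.Perm (Fin n), ∑ v : Fin (n + 1), f (insertLast v σ) := by
  rw [← (insertLast_bijective n).sum_comp f, Fintype.sum_prod_type, Finset.sum_comm]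

/-- The new inversions pair the last position with the `n - v` earlier values above `v`. This extra
term does not involve `σ`, which is the source of independence. -/
theorem inversions_insertLast {n : ℕ} (v : Fin (n + 1)) (σ : Equiv.Perm (Fin n)) :
    inversions (insertLast v σ) = inversions σ + (n - v) := by
  have hcount : ∑ i : Fin n, (if v ≤ (σ i).castSucc then 1 else 0) = n - (v : ℕ) := by
    rw [Equiv.sum_comp σ fun i : Fin n => if v ≤ i.castSucc then 1 else 0]
    simp only [Fin.le_def, Fin.val_castSucc]
    rw [Fin.sum_univ_eq_sum_range (fun i => if (v : ℕ) ≤ i then 1 else 0) n,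
      ← Finset.card_filter]
    have : (Finset.range n).filter (fun i => (v : ℕ) ≤ i) = Finset.Ico (v : ℕ) n := by
      ext i
      simp [and_comm]
    rw [this, Nat.card_Ico]
  simp only [inversions, Finset.card_filter, Fintype.sum_prod_type, Fin.sum_univ_castSucc,
    insertLast_castSucc, insertLast_last, Fin.castSucc_lt_castSucc_iff, Fin.succAbove_lt_succAbove_iff,
    Fin.castSucc_lt_last, true_and, lt_irrefl, false_and, if_false, add_zero,
    (Fin.castSucc_lt_last _).not_gt, Finset.sum_const_zero, Finset.sum_add_distrib,
    Fin.lt_succAbove_iff_le_castSucc, hcount]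

theorem isLTRMax_insertLast_castSucc {n : ℕ} (v : Fin (n + 1)) (σ : Equiv.Perm (Fin n))
    (p : Fin n) : IsLTRMax (insertLast v σ) p.castSucc ↔ IsLTRMax σ p := by
  simp [IsLTRMax, Fin.forall_fin_succ', (Fin.castSucc_lt_last _).not_gt,
    Fin.succAbove_lt_succAbove_iff]

theorem isLTRMax_insertLast_last {n : ℕ} (v : Fin (n + 1)) (σ : Equiv.Perm (Fin n)) :
    IsLTRMax (insertLast v σ) (Fin.last n) ↔ v = Fin.last n := by
  constructor
  · intro h
    by_contra hv
    obtain ⟨j, rfl⟩ := Fin.exists_castSucc_eq.2 hv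
    have := h (σ.symm j).castSucc (Fin.castSucc_lt_last _)
    simp only [insertLast_castSucc, Equiv.apply_symm_apply, Fin.succAbove_castSucc_self,
      insertLast_last] at this
    exact this.not_gt Fin.castSucc_lt_succ
  · rintro rfl q hq
    obtain ⟨q, rfl⟩ := Fin.exists_castSucc_eq.2 hq.ne
    simp [Fin.castSucc_lt_last]

theorem accepts_insertLast_castSucc {n s : ℕ} (k : Fin s → ℕ) (v : Fin (n + 1))
    (σ : Equiv.Perm (Fin n)) (r : ℕ) (p : Fin n) :
    Accepts k (insertLast v σ) r p.castSucc ↔ Accepts k σ r p := by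
  simp [Accepts, isLTRMax_insertLast_castSucc]

theorem accepts_insertLast_last {n s : ℕ} (k : Fin s → ℕ) (v : Fin (n + 1))
    (σ : Equiv.Perm (Fin n)) (r : ℕ) :
    Accepts k (insertLast v σ) r (Fin.last n) ↔
      (∃ hr : r < s, k ⟨r, hr⟩ ≤ n) ∧ v = Fin.last n := by
  simp [Accepts, isLTRMax_insertLast_last]

theorem numSelections_insertLast {n s : ℕ} (k : Fin s → ℕ) (v : Fin (n + 1))
    (σ : Equiv.Perm (Fin n)) {m : ℕ} (hm : m ≤ n) :
    numSelections k (insertLast v σ) m = numSelections k σ m := by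
  induction m with
  | zero => rfl
  | succ m ih =>
    have hiff : (∃ h : m < n + 1, Accepts k (insertLast v σ) (numSelections k σ m) ⟨m, h⟩) ↔
        ∃ h : m < n, Accepts k σ (numSelections k σ m) ⟨m, h⟩ := by
      rw [exists_prop_of_true (show m < n + 1 by lia), exists_prop_of_true (show m < n by lia)]
      exact accepts_insertLast_castSucc k v σ _ ⟨m, by lia⟩
    simp only [numSelections, ih (by lia), hiff]

theorem numSelections_insertLast_succ {n s : ℕ} (k : Fin s → ℕ) (v : Fin (n + 1))
    (σ : Equiv.Perm (Fin n)) :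
    numSelections k (insertLast v σ) (n + 1) =
      if (∃ hr : numSelections k σ n < s, k ⟨numSelections k σ n, hr⟩ ≤ n) ∧ v = Fin.last n
        then numSelections k σ n + 1 else numSelections k σ n := by
  rw [numSelections, numSelections_insertLast k v σ le_rfl]
  exact if_congr ((exists_prop_of_true (Nat.lt_succ_self n)).trans
    (accepts_insertLast_last k v σ _)) rfl rfl

theorem winnable_insertLast_last {n s : ℕ} (k : Fin s → ℕ) (σ : Equiv.Perm (Fin n)) :
    Winnable k (insertLast (Fin.last n) σ) ↔
      ∃ hr : numSelections k σ n < s, k ⟨numSelections k σ n, hr⟩ ≤ n := by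
  constructor
  · rintro ⟨p, hp, hacc⟩
    have hpl : p = Fin.last n := by
      by_contra hne
      obtain ⟨q, rfl⟩ := Fin.exists_castSucc_eq.2 hne
      simpa using hp (Fin.last n)
    subst hpl
    rw [accepts_insertLast_last, Fin.val_last, numSelections_insertLast k _ σ le_rfl] at hacc
    exact hacc.1
  · intro h
    refine ⟨Fin.last n, fun q => by simpa using Fin.le_last _, ?_⟩
    rw [accepts_insertLast_last, Fin.val_last, numSelections_insertLast k _ σ le_rfl]
    exact ⟨h, rfl⟩

theorem winnable_insertLast_castSucc {n s : ℕ} (k : Fin s → ℕ) (v : Fin n)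
    (σ : Equiv.Perm (Fin n)) :
    Winnable k (insertLast v.castSucc σ) ↔ Winnable k σ := by
  have key : ∀ p : Fin n, Accepts k (insertLast v.castSucc σ)
      (numSelections k (insertLast v.castSucc σ) p.castSucc) p.castSucc ↔
      Accepts k σ (numSelections k σ p) p := fun p => by
    rw [accepts_insertLast_castSucc, Fin.val_castSucc, numSelections_insertLast k _ σ p.2.le]
  constructor
  · rintro ⟨p, hp, hacc⟩
    have hpl : p ≠ Fin.last n := by
      rintro rfl
      have := hp (σ.symm v).castSucc
      simp at this
    obtain ⟨p, rfl⟩ := Fin.exists_castSucc_eq.2 hpl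
    refine ⟨p, fun q => ?_, (key p).1 hacc⟩
    have := hp q.castSucc
    simpa [Fin.succAbove_le_succAbove_iff] using this
  · rintro ⟨p, hp, hacc⟩
    refine ⟨p.castSucc, fun q => ?_, (key p).2 hacc⟩
    induction q using Fin.lastCases with
    | last =>
      have h1 : v ≤ σ p := by simpa using hp (σ.symm v)
      simpa using ((Fin.lt_succAbove_iff_le_castSucc _ _).2 (Fin.castSucc_le_castSucc_iff.2 h1)).le
    | cast q => simpa [Fin.succAbove_le_succAbove_iff] using hp q

/-! ### Reduction to independent left-to-right maxima -/

/-- The probability that none of the positions `p, …, p + m - 1` is a left-to-right maximum, when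
position `q` is one with probability `a q`, independently. -/
def noMaxProb (a : ℕ → ℝ) : ℕ → ℕ → ℝ
  | 0, _ => 1
  | m + 1, p => (1 - a p) * noMaxProb a m (p + 1)

/-- The probability that the last left-to-right maximum among the positions `p, …, p + m - 1`
exists and is selected by the strategy with the list `l` of thresholds, when position `q` is a
left-to-right maximum with probability `a q`, independently. -/
noncomputable def suffixWin (a : ℕ → ℝ) : ℕ → ℕ → List ℕ → ℝ
  | 0, _, _ => 0
  | _ + 1, _, [] => 0
  | m + 1, p, c :: l =>
    a p * (if c ≤ p then suffixWin a m (p + 1) l + noMaxProb a m (p + 1)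
      else suffixWin a m (p + 1) (c :: l)) + (1 - a p) * suffixWin a m (p + 1) (c :: l)

@[simp]
theorem suffixWin_nil (a : ℕ → ℝ) (m p : ℕ) : suffixWin a m p [] = 0 := by
  cases m <;> simp [suffixWin]

/-- The probability that position `p` is a left-to-right maximum. -/
noncomputable def maxProb (θ : ℝ) (p : ℕ) : ℝ := (∑ j ∈ Finset.range (p + 1), θ ^ j)⁻¹

theorem geom_pos {θ : ℝ} (hθ : 0 < θ) (p : ℕ) : 0 < ∑ j ∈ Finset.range (p + 1), θ ^ j :=
  Finset.sum_pos (fun _ _ => pow_pos hθ _) (by simp)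

theorem sum_pow_sub (θ : ℝ) (n : ℕ) :
    ∑ v : Fin n, θ ^ (n - (v : ℕ)) = ∑ j ∈ Finset.range (n + 1), θ ^ j - 1 := by
  rw [Fin.sum_univ_eq_sum_range (fun v => θ ^ (n - v)) n, Finset.sum_range_succ' _ n,
    ← Finset.sum_range_reflect]
  simp only [pow_zero, add_sub_cancel_right]
  refine Finset.sum_congr rfl fun j hj => ?_
  rw [Finset.mem_range] at hj
  congr 1
  lia

theorem sum_pow_inversions_succ (θ : ℝ) (n : ℕ) :
    ∑ π : Equiv.Perm (Fin (n + 1)), θ ^ inversions π =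
      (∑ j ∈ Finset.range (n + 1), θ ^ j) * ∑ σ : Equiv.Perm (Fin n), θ ^ inversions σ := by
  rw [sum_perm_succ, Finset.mul_sum]
  refine Finset.sum_congr rfl fun σ _ => ?_
  simp only [inversions_insertLast, pow_add, ← Finset.mul_sum]
  rw [Fin.sum_univ_castSucc]
  simp only [Fin.val_castSucc, sum_pow_sub, Fin.val_last, Nat.sub_self, pow_zero]
  ring

/-- The conditional probability of winning on a list of length `n + m`, given the relative order `σ`
of the first `n` candidates. -/
noncomputable def condWin (θ : ℝ) {n s : ℕ} (k : Fin s → ℕ) (m : ℕ) (σ : Equiv.Perm (Fin n)) : ℝ :=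
  suffixWin (maxProb θ) m n ((List.ofFn k).drop (numSelections k σ n)) +
    (if Winnable k σ then 1 else 0) * noMaxProb (maxProb θ) m n

/-- Martingale step: only `v = Fin.last n`, of weight `1`, creates a new maximum; for all other `v`
the selections and winnability stay those of `σ`. -/
theorem sum_condWin_insertLast {θ : ℝ} (hθ : 0 < θ) {n s : ℕ} (k : Fin s → ℕ) (m : ℕ)
    (σ : Equiv.Perm (Fin n)) :
    ∑ v : Fin (n + 1), θ ^ (n - (v : ℕ)) * condWin θ k m (insertLast v σ) =
      (∑ j ∈ Finset.range (n + 1), θ ^ j) * condWin θ k (m + 1) σ := by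
  have hS := geom_pos hθ n
  have hne : ∀ v : Fin n, v.castSucc ≠ Fin.last n := fun v => (Fin.castSucc_lt_last v).ne
  rw [Fin.sum_univ_castSucc]
  simp only [condWin, winnable_insertLast_castSucc, winnable_insertLast_last,
    numSelections_insertLast_succ, hne, and_false, if_false, and_true, Fin.val_castSucc,
    ← Finset.sum_mul, sum_pow_sub, Fin.val_last, Nat.sub_self, pow_zero, one_mul]
  set r := numSelections k σ n
  by_cases hr : r < s
  · have hdrop : (List.ofFn k).drop r = k ⟨r, hr⟩ :: (List.ofFn k).drop (r + 1) := by
      rw [List.drop_eq_getElem_cons (by simpa using hr)]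
      simp
    by_cases hk : k ⟨r, hr⟩ ≤ n
    · have hex : ∃ hr : r < s, k ⟨r, hr⟩ ≤ n := ⟨hr, hk⟩
      simp only [hex, if_true]
      simp only [hdrop, suffixWin, hk, if_true, noMaxProb]
      rw [maxProb]
      field_simp
      ring
    · have hex : ¬ ∃ hr : r < s, k ⟨r, hr⟩ ≤ n := fun h => hk h.2
      simp only [hex, if_false]
      simp only [hdrop, suffixWin, hk, if_false, noMaxProb]
      rw [maxProb]
      field_simp
      ring
  · have hex : ¬ ∃ hr : r < s, k ⟨r, hr⟩ ≤ n := fun h => hr h.1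
    have hdrop : (List.ofFn k).drop r = [] := List.drop_eq_nil_of_le (by simpa using hr)
    simp only [hex, if_false, hdrop, suffixWin_nil, noMaxProb]
    rw [maxProb]
    field_simp
    ring

theorem sum_condWin {θ : ℝ} (hθ : 0 < θ) {s : ℕ} (k : Fin s → ℕ) (n m : ℕ) :
    ∑ σ : Equiv.Perm (Fin n), θ ^ inversions σ * condWin θ k m σ =
      (∑ σ : Equiv.Perm (Fin n), θ ^ inversions σ) *
        suffixWin (maxProb θ) (n + m) 0 (List.ofFn k) := by
  -- Each step moves one position from the revealed prefix to the future, so `n + m` stays fixed.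
  induction n generalizing m with
  | zero => simp [condWin, numSelections, Winnable]
  | succ n ih =>
    rw [sum_perm_succ, sum_pow_inversions_succ]
    simp only [inversions_insertLast, pow_add, mul_assoc, ← Finset.mul_sum,
      sum_condWin_insertLast hθ]
    simp only [mul_left_comm _ (∑ j ∈ Finset.range (n + 1), θ ^ j), ← Finset.mul_sum]
    rw [ih (m + 1), show n + 1 + m = n + (m + 1) by lia]

theorem winProb_eq {θ : ℝ} (hθ : 0 < θ) (N : ℕ) {s : ℕ} (k : Fin s → ℕ) :
    winProb θ N k = suffixWin (maxProb θ) N 0 (List.ofFn k) := by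
  have hpos : 0 < ∑ σ : Equiv.Perm (Fin N), θ ^ inversions σ :=
    Finset.sum_pos (fun _ _ => pow_pos hθ _) Finset.univ_nonempty
  have h := sum_condWin hθ k N 0
  simp only [condWin, suffixWin, noMaxProb, zero_add, mul_one, mul_ite, mul_zero, add_zero] at h
  simp only [winProb, prob]
  rw [← Finset.sum_div, Finset.sum_filter, h, mul_div_cancel_left₀ _ hpos.ne']

/-! ### Geometric bounds -/

section Bounds

variable {θ : ℝ}

theorem maxProb_le_one (hθ0 : 0 < θ) (p : ℕ) : maxProb θ p ≤ 1 := by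
  refine inv_le_one_of_one_le₀ ?_
  rw [Finset.sum_range_succ', pow_zero]
  have : 0 ≤ ∑ j ∈ Finset.range p, θ ^ (j + 1) := Finset.sum_nonneg fun _ _ => by positivity
  linarith

theorem one_sub_le_maxProb (hθ0 : 0 < θ) (p : ℕ) : 1 - θ ≤ maxProb θ p := by
  rw [maxProb, ← one_div, le_div_iff₀ (geom_pos hθ0 p), mul_neg_geom_sum]
  have : 0 < θ ^ (p + 1) := by positivity
  linarith

theorem maxProb_nonneg (hθ0 : 0 < θ) (p : ℕ) : 0 ≤ maxProb θ p :=
  inv_nonneg.2 (geom_pos hθ0 p).le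

/-- Position `0` is always a maximum, hence `1 ≤ p`. The bound rests on `(1 + θ) * (1 - θ + θ ^ 2) =
1 + θ ^ 3`. -/
theorem mul_one_sub_le_one_sub_maxProb (hθ0 : 0 < θ) {p : ℕ} (hp : 1 ≤ p) :
    θ * (1 - θ) ≤ 1 - maxProb θ p := by
  have h1 : (1 + θ) ≤ ∑ j ∈ Finset.range (p + 1), θ ^ j := by
    have : ∑ j ∈ Finset.range 2, θ ^ j = 1 + θ := by simp [Finset.sum_range_succ]
    rw [← this]
    exact Finset.sum_le_sum_of_subset_of_nonneg
      (fun x hx => by simp only [Finset.mem_range] at *; lia) fun _ _ _ => by positivity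
  have h2 : maxProb θ p ≤ (1 + θ)⁻¹ := inv_anti₀ (by positivity) h1
  have h3 : (1 + θ)⁻¹ ≤ 1 - θ * (1 - θ) := by
    rw [← one_div, div_le_iff₀ (by positivity)]
    have : 0 < θ ^ 3 := by positivity
    nlinarith
  linarith

theorem noMaxProb_nonneg (hθ0 : 0 < θ) (m p : ℕ) : 0 ≤ noMaxProb (maxProb θ) m p := by
  induction m generalizing p with
  | zero => simp [noMaxProb]
  | succ m ih => exact mul_nonneg (sub_nonneg.2 (maxProb_le_one hθ0 p)) (ih _)

theorem noMaxProb_le (hθ0 : 0 < θ) (m p : ℕ) : noMaxProb (maxProb θ) m p ≤ θ ^ m := by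
  induction m generalizing p with
  | zero => simp [noMaxProb]
  | succ m ih =>
    rw [pow_succ', noMaxProb]
    exact mul_le_mul (by linarith [one_sub_le_maxProb hθ0 p]) (ih _) (noMaxProb_nonneg hθ0 _ _)
      hθ0.le

theorem le_noMaxProb (hθ0 : 0 < θ) (hθ1 : θ < 1) (m : ℕ) {p : ℕ} (hp : 1 ≤ p) :
    (θ * (1 - θ)) ^ m ≤ noMaxProb (maxProb θ) m p := by
  induction m generalizing p with
  | zero => simp [noMaxProb]
  | succ m ih =>
    have : 0 ≤ θ * (1 - θ) := mul_nonneg hθ0.le (by linarith)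
    have h := mul_one_sub_le_one_sub_maxProb hθ0 hp
    rw [pow_succ', noMaxProb]
    exact mul_le_mul h (ih (by lia)) (by positivity) (this.trans h)

theorem suffixWin_nonneg (hθ0 : 0 < θ) (m p : ℕ) (l : List ℕ) :
    0 ≤ suffixWin (maxProb θ) m p l := by
  induction m generalizing p l with
  | zero => simp [suffixWin]
  | succ m ih =>
    cases l with
    | nil => simp
    | cons c l =>
      refine add_nonneg (mul_nonneg (maxProb_nonneg hθ0 p) ?_)
        (mul_nonneg (sub_nonneg.2 (maxProb_le_one hθ0 p)) (ih _ _))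
      split_ifs
      exacts [add_nonneg (ih _ _) (noMaxProb_nonneg hθ0 _ _), ih _ _]

end Bounds

/-! ### Shifting thresholds and positions -/

/-- Thresholds that have already been passed may be replaced by the current position. -/
theorem suffixWin_map_max (a : ℕ → ℝ) (m : ℕ) {p q : ℕ} (hpq : q ≤ p) (l : List ℕ) :
    suffixWin a m p (l.map (max q)) = suffixWin a m p l := by
  induction m generalizing p l with
  | zero => simp [suffixWin]
  | succ m ih =>
    cases l with
    | nil => simp
    | cons c l =>
      have h1 := ih (p := p + 1) (by lia) l
      have h2 := ih (p := p + 1) (by lia) (c :: l)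
      rw [List.map_cons] at h2 ⊢
      simp only [suffixWin, h1, h2, max_le_iff, hpq, true_and]

/-- Nothing happens before the first threshold. -/
theorem suffixWin_skip (a : ℕ → ℝ) (m p j : ℕ) {l : List ℕ} (hl : ∀ c ∈ l, p + j ≤ c) :
    suffixWin a (j + m) p l = suffixWin a m (p + j) l := by
  induction j generalizing p with
  | zero => simp
  | succ j ih =>
    cases l with
    | nil => simp
    | cons c l =>
      have hc : ¬ c ≤ p := by
        have := hl c (by simp)
        lia
      have := ih (p + 1) fun c hc => by have := hl c hc; lia
      rw [show j + 1 + m = (j + m) + 1 by lia, suffixWin, if_neg hc, this,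
        show p + (j + 1) = p + 1 + j by lia]
      ring

/-- `l` is the list of thresholds of an `s`-threshold strategy for lists of length `N`. -/
def IsThresholdList (N s : ℕ) (l : List ℕ) : Prop :=
  l.Pairwise (· ≤ ·) ∧ l.length = s ∧ ∀ c ∈ l, c < N

theorem suffixWin_le_of_isThresholdList {a : ℕ → ℝ} {N s : ℕ} {M : ℝ} (hM : 0 ≤ M)
    (h : ∀ l, IsThresholdList N s l → suffixWin a N 0 l ≤ M) {l : List ℕ}
    (hl : IsThresholdList N s l) {m p : ℕ} (hmp : m + p = N) : suffixWin a m p l ≤ M := by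
  cases m with
  | zero => simpa [suffixWin] using hM
  | succ m =>
    -- Raising all thresholds to at least `p` makes the suffix problem a full problem from position
    -- `0`.
    have h1 := suffixWin_skip a (m + 1) 0 p (l := l.map (max p)) (by simp)
    rw [zero_add, suffixWin_map_max a _ le_rfl, show p + (m + 1) = N by lia] at h1
    rw [← h1]
    refine h _ ⟨?_, by simpa using hl.2.1, ?_⟩
    · exact hl.1.map _ fun _ _ hab => max_le_max le_rfl hab
    · intro c hc
      obtain ⟨d, hd, rfl⟩ := List.mem_map.1 hc
      exact max_lt (by lia) (hl.2.2 d hd)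

/-! ### Comparing `s` and `s + 1` selections -/

section Compare

variable {θ : ℝ}

/-- If the first selection may already be made, the first selected candidate is the best one only if
it is the only remaining left-to-right maximum. -/
theorem suffixWin_cons_le_of_le (hθ0 : 0 < θ) {N : ℕ} {M : ℝ} {l : List ℕ}
    (hM : ∀ m p, m + p = N → suffixWin (maxProb θ) m p l ≤ M) (hM0 : 0 ≤ M) {c : ℕ} (m p : ℕ)
    (hmp : m + p = N) (hc : c ≤ p) :
    suffixWin (maxProb θ) m p (c :: l) ≤ M + m * θ ^ (m - 1) := by
  induction m generalizing p with
  | zero => simpa [suffixWin] using hM0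
  | succ m ih =>
    have h0 := maxProb_nonneg hθ0 p
    have h1 := maxProb_le_one hθ0 p
    have h2 := one_sub_le_maxProb hθ0 p
    have hZ := noMaxProb_le hθ0 m (p + 1)
    have hl := hM m (p + 1) (by lia)
    have hcl := ih (p + 1) (by lia) (by lia)
    rw [suffixWin, if_pos hc]
    -- The error splits as `(m + 1) * θ ^ m = θ ^ m + θ * (m * θ ^ (m - 1))`: a maximum at `p` with
    -- none after it, or none at `p`.
    have hm : θ * (m * θ ^ (m - 1)) = m * θ ^ m := by
      cases m with
      | zero => simp
      | succ m => rw [Nat.add_sub_cancel, pow_succ]; ring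
    have e1 : maxProb θ p * (suffixWin (maxProb θ) m (p + 1) l +
        noMaxProb (maxProb θ) m (p + 1)) ≤ maxProb θ p * M + 1 * θ ^ m := by
      have := mul_le_mul h1 le_rfl (pow_nonneg hθ0.le m) zero_le_one
      have := mul_le_mul_of_nonneg_left (add_le_add hl hZ) h0
      linarith
    have e2 : (1 - maxProb θ p) * suffixWin (maxProb θ) m (p + 1) (c :: l) ≤
        (1 - maxProb θ p) * M + θ * (m * θ ^ (m - 1)) := by
      have := mul_le_mul_of_nonneg_left hcl (sub_nonneg.2 h1)
      have := mul_le_mul_of_nonneg_right (show 1 - maxProb θ p ≤ θ by linarith)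
        (show 0 ≤ m * θ ^ (m - 1) by positivity)
      linarith
    rw [hm] at e2
    rw [Nat.add_sub_cancel]
    push_cast
    linarith

theorem suffixWin_cons_le (hθ0 : 0 < θ) {N s : ℕ} {M : ℝ} (hM0 : 0 ≤ M)
    (hM : ∀ l, IsThresholdList N s l → suffixWin (maxProb θ) N 0 l ≤ M) {c : ℕ} {l : List ℕ}
    (hl : IsThresholdList N (s + 1) (c :: l)) :
    suffixWin (maxProb θ) N 0 (c :: l) ≤ M + (N - c : ℕ) * θ ^ (N - c - 1) := by
  obtain ⟨hs, hlen, hlt⟩ := hl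
  rw [List.pairwise_cons] at hs
  have hcN := hlt c (by simp)
  have hskip := suffixWin_skip (maxProb θ) (N - c) 0 c (l := c :: l) (by simpa using hs.1)
  rw [show c + (N - c) = N by lia, zero_add] at hskip
  rw [hskip]
  refine suffixWin_cons_le_of_le hθ0 (N := N) (fun m p hmp => ?_) hM0 _ _ (by lia) le_rfl
  exact suffixWin_le_of_isThresholdList hM0 hM
    ⟨hs.2, by simpa using hlen, fun d hd => hlt d (by simp [hd])⟩ hmp

/-- An additional selection in front does not hurt. -/
theorem suffixWin_le_cons (hθ0 : 0 < θ) (m p : ℕ) {c : ℕ} {l : List ℕ}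
    (hl : (c :: l).Pairwise (· ≤ ·)) :
    suffixWin (maxProb θ) m p l ≤ suffixWin (maxProb θ) m p (c :: l) := by
  induction m generalizing p c l with
  | zero => simp [suffixWin]
  | succ m ih =>
    cases l with
    | nil => simpa using suffixWin_nonneg hθ0 _ _ _
    | cons d l =>
      have hcd : c ≤ d := (List.pairwise_cons.1 hl).1 d (by simp)
      have h1 := ih (p + 1) hl
      have h2 := ih (p + 1) (List.pairwise_cons.1 hl).2
      have hZ := noMaxProb_nonneg hθ0 m (p + 1)
      rw [suffixWin, suffixWin]
      refine add_le_add (mul_le_mul_of_nonneg_left ?_ (maxProb_nonneg hθ0 p))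
        (mul_le_mul_of_nonneg_left h1 (sub_nonneg.2 (maxProb_le_one hθ0 p)))
      split_ifs with hd hc hc
      · linarith
      · lia
      · linarith
      · exact h1

/-- A lower bound for the gain of an additional selection in front. -/
theorem suffixWin_add_le_cons (hθ0 : 0 < θ) (hθ1 : θ < 1) {N c : ℕ} (hcN : c < N) {l : List ℕ}
    (hl : ∀ d ∈ l, c < d) (hs : l.Pairwise (· ≤ ·)) :
    suffixWin (maxProb θ) N 0 l + (1 - θ) * (θ * (1 - θ)) ^ (N - c - 1) ≤
      suffixWin (maxProb θ) N 0 (c :: l) := by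
  obtain ⟨m, rfl⟩ : ∃ m, N = c + (m + 1) := ⟨N - c - 1, by lia⟩
  rw [suffixWin_skip _ (m + 1) 0 c (l := l) (fun d hd => by have := hl d hd; lia),
    suffixWin_skip _ (m + 1) 0 c (l := c :: l) (by simpa using fun d hd => (hl d hd).le),
    zero_add, show c + (m + 1) - c - 1 = m by lia]
  have hcl : (c :: l).Pairwise (· ≤ ·) := List.pairwise_cons.2 ⟨fun d hd => (hl d hd).le, hs⟩
  have hle := suffixWin_le_cons hθ0 m (c + 1) hcl
  have hl1 : suffixWin (maxProb θ) (m + 1) c l = suffixWin (maxProb θ) m (c + 1) l := by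
    rw [add_comm m 1]
    exact suffixWin_skip _ m c 1 hl
  rw [suffixWin, if_pos le_rfl, hl1]
  -- The gain comes from the event that `c` is a maximum and the last one, where `l` cannot yet
  -- select.
  have hZ := mul_le_mul (one_sub_le_maxProb hθ0 c) (le_noMaxProb hθ0 hθ1 m (p := c + 1) (by lia))
    (pow_nonneg (mul_nonneg hθ0.le (by linarith)) m) (maxProb_nonneg hθ0 c)
  have := mul_le_mul_of_nonneg_left hle (sub_nonneg.2 (maxProb_le_one hθ0 c))
  linarith

theorem exists_max_isThresholdList (a : ℕ → ℝ) {N : ℕ} (hN : 1 ≤ N) (s : ℕ) :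
    ∃ l, IsThresholdList N s l ∧ ∀ l', IsThresholdList N s l' →
      suffixWin a N 0 l' ≤ suffixWin a N 0 l := by
  have hfin : {l | IsThresholdList N s l}.Finite := by
    refine (Set.finite_range fun v : List.Vector (Fin N) s => v.toList.map Fin.val).subset ?_
    rintro l ⟨-, hlen, hlt⟩
    refine ⟨⟨l.pmap (fun c hc => ⟨c, hc⟩) hlt, by simpa using hlen⟩, ?_⟩
    simp [List.map_pmap]
  have hne : {l | IsThresholdList N s l}.Nonempty := by
    refine ⟨List.replicate s 0, ?_, by simp, fun c hc => ?_⟩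
    · exact List.pairwise_replicate.2 (Or.inr le_rfl)
    · rw [List.eq_of_mem_replicate hc]
      lia
  obtain ⟨l, hl, hmax⟩ := Set.exists_max_image _ (suffixWin a N 0) hfin hne
  exact ⟨l, hl, hmax⟩

/-- Strategies whose first threshold is far from the end of the list are suboptimal, if one more
selection increases the optimal probability of winning. -/
theorem exists_better_of_gain (hθ0 : 0 < θ) (hθ1 : θ < 1) {s : ℕ} {δ : ℝ} (hδ : 0 < δ) {N₀ : ℕ}
    (h : ∀ N, N₀ ≤ N → ∀ l, IsThresholdList N s l → ∃ l', IsThresholdList N (s + 1) l' ∧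
      suffixWin (maxProb θ) N 0 l + δ ≤ suffixWin (maxProb θ) N 0 l') :
    ∃ C : ℕ, ∀ N, N₀ ≤ N → ∀ c l, IsThresholdList N (s + 1) (c :: l) → c + C < N →
      ∃ l', IsThresholdList N (s + 1) l' ∧
        suffixWin (maxProb θ) N 0 (c :: l) + δ / 2 ≤ suffixWin (maxProb θ) N 0 l' := by
  have hlim : Tendsto (fun n : ℕ => (n : ℝ) * θ ^ (n - 1)) atTop (nhds 0) := by
    have := (tendsto_self_mul_const_pow_of_lt_one hθ0.le hθ1).const_mul θ⁻¹
    rw [mul_zero] at this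
    refine this.congr' ?_
    filter_upwards [eventually_ge_atTop 1] with n hn
    obtain ⟨m, rfl⟩ := Nat.exists_eq_add_of_le' hn
    rw [Nat.add_sub_cancel, pow_succ]
    field_simp
  obtain ⟨C, hC⟩ := eventually_atTop.1 (hlim.eventually_lt_const (half_pos hδ))
  refine ⟨C, fun N hN c l hcl hcN => ?_⟩
  obtain ⟨lm, hlm, hmax⟩ := exists_max_isThresholdList (maxProb θ) (N := N) (by lia) s
  obtain ⟨l', hl', hgain⟩ := h N hN lm hlm
  refine ⟨l', hl', ?_⟩
  have h1 := suffixWin_cons_le hθ0 (suffixWin_nonneg hθ0 _ _ _) hmax hcl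
  have h2 := hC (N - c) (by lia)
  linarith

/-- One more selection increases the optimal probability of winning. -/
theorem exists_gain (hθ0 : 0 < θ) (hθ1 : θ < 1) (s : ℕ) :
    ∃ δ : ℝ, 0 < δ ∧ ∃ N₀ : ℕ, ∀ N, N₀ ≤ N → ∀ l, IsThresholdList N s l →
      ∃ l', IsThresholdList N (s + 1) l' ∧
        suffixWin (maxProb θ) N 0 l + δ ≤ suffixWin (maxProb θ) N 0 l' := by
  have hβ : 0 < θ * (1 - θ) := mul_pos hθ0 (by linarith)
  induction s with
  | zero =>
    refine ⟨1 - θ, by linarith, 1, fun N hN l hl => ?_⟩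
    obtain rfl : l = [] := List.eq_nil_of_length_eq_zero hl.2.1
    refine ⟨[N - 1], ⟨by simp, by simp, by simp; lia⟩, ?_⟩
    have := suffixWin_add_le_cons hθ0 hθ1 (N := N) (c := N - 1) (by lia) (l := []) (by simp)
      (by simp)
    rwa [show N - (N - 1) - 1 = 0 by lia, pow_zero, mul_one] at this
  | succ s ih =>
    obtain ⟨δ, hδ, N₀, h⟩ := ih
    obtain ⟨C, hC⟩ := exists_better_of_gain hθ0 hθ1 hδ h
    -- This is the gain from a new threshold at `N - C - 1`, followed by `C` positions; `C + 1 ≤ N`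
    -- makes the subtraction genuine.
    refine ⟨(1 - θ) * (θ * (1 - θ)) ^ C, mul_pos (by linarith) (pow_pos hβ C), max N₀ (C + 1),
      fun N hN l hl => ?_⟩
    rw [max_le_iff] at hN
    obtain ⟨lm, hlm, hmax⟩ := exists_max_isThresholdList (maxProb θ) (N := N) (by lia) (s + 1)
    -- An optimal list cannot start before `N - C`, as `hC` would improve it.
    have hlow : ∀ d ∈ lm, N - C - 1 < d := by
      obtain ⟨c, l', rfl⟩ : ∃ c l', lm = c :: l' := List.exists_cons_of_length_eq_add_one hlm.2.1
      have hc : N ≤ c + C := by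
        by_contra! hlt
        obtain ⟨l'', hl'', hlt'⟩ := hC N hN.1 c l' hlm hlt
        linarith [hmax l'' hl'']
      have hs := (List.pairwise_cons.1 hlm.1).1
      intro d hd
      rcases List.mem_cons.1 hd with rfl | hd
      · lia
      · have := hs d hd
        lia
    have hgain := suffixWin_add_le_cons hθ0 hθ1 (N := N) (c := N - C - 1) (by lia) hlow hlm.1
    rw [show N - (N - C - 1) - 1 = C by lia] at hgain
    refine ⟨(N - C - 1) :: lm, ⟨?_, by simpa using hlm.2.1, ?_⟩, by linarith [hmax l hl]⟩
    · exact List.pairwise_cons.2 ⟨fun d hd => (hlow d hd).le, hlm.1⟩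
    · intro d hd
      rcases List.mem_cons.1 hd with rfl | hd
      · lia
      · exact hlm.2.2 d hd

end Compare

/-! ### Conclusion for threshold vectors -/

theorem isThresholdList_ofFn {N s : ℕ} {k : Fin s → ℕ} :
    IsThresholdList N s (List.ofFn k) ↔ IsThresholdVector N k := by
  simp [IsThresholdList, IsThresholdVector, List.pairwise_ofFn, List.mem_ofFn,
    monotone_iff_forall_lt]

end Mallows

theorem mainTheorem6 (θ : ℝ) (hθ0 : 0 < θ) (hθ1 : θ < 1) (s : ℕ) (hs : 1 ≤ s) :
    ∃ C : ℕ, ∀ k : ℕ → Fin s → ℕ, Mallows.AsymptoticallyOptimal θ k →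
      ∀ᶠ N : ℕ in atTop, ∀ i : Fin s, (N : ℤ) - (k N i : ℤ) ≤ (C : ℤ) := by
  obtain ⟨s, rfl⟩ := Nat.exists_eq_add_of_le' hs
  obtain ⟨δ, hδ, N₀, hgain⟩ := Mallows.exists_gain hθ0 hθ1 s
  obtain ⟨C, hC⟩ := Mallows.exists_better_of_gain hθ0 hθ1 hδ hgain
  refine ⟨C, fun k hk => ?_⟩
  -- Any tolerance below the loss `δ / 2` of an early first threshold works.
  filter_upwards [hk.2 (δ / 4) (by linarith), eventually_ge_atTop (max N₀ 1)] with N hopt hN i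
  rw [max_le_iff] at hN
  have hvec := hk.1 N hN.2
  have h0 : N ≤ k N 0 + C := by
    by_contra! hlt
    have hlist := Mallows.isThresholdList_ofFn.2 hvec
    rw [List.ofFn_succ] at hlist
    obtain ⟨l, hl, hbetter⟩ := hC N hN.1 _ _ hlist hlt
    rw [← List.ofFn_succ, ← Mallows.winProb_eq hθ0] at hbetter
    obtain ⟨k', rfl⟩ : ∃ k' : Fin (s + 1) → ℕ, List.ofFn k' = l := by
      have hlen := hl.2.1
      generalize s + 1 = t at hlen
      subst hlen
      exact ⟨l.get, List.ofFn_get l⟩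
    rw [← Mallows.winProb_eq hθ0] at hbetter
    linarith [hopt k' (Mallows.isThresholdList_ofFn.1 hl)]
  have := hvec.1 (Fin.zero_le i)
  lia
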